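/- Let $(M_n)_{n\ge 0}$ be a sequence of positive real numbers with $M_0=1$ and $\frac{M_{n+m}}{M_nM_m}\ge\binom{n+m}{n}$ for all non-negative integers $m,n$, and suppose that $(M_n)$ is non-analytic, i.e. $\lim_{n\to\infty}(n!/M_n)^{1/n}=0$. Let $D([0,1],M)$ be the algebra of all infinitely differentiable functions $f:[0,1]\to\mathbb{C}$ (with one-sided derivatives at the endpoints) such that $\sum_{n=0}^{\infty}\|f^{(n)}\|_\infty/M_n<\infty$, where $\|\cdot\|_\infty$ is the supremum norm on $[0,1]$. Let $\phi:[0,1]\to[0,1]$ be any map that induces an endomorphism of $D([0,1],M)$, i.e. such that $f\circ\phi\in D([0,1],M)$ for every $f\in D([0,1],M)$. Then $\phi$ is infinitely differentiable on $[0,1]$ and $\|\phi'\|_\infty\le 1$. -/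

import Mathlib

open Set Filter Topology
open scoped ContDiff

/-- A weight sequence: positive numbers `M n` with `M 0 = 1` and
`M (n + m) / (M n * M m) ≥ (n + m).choose n` for all `n`, `m`. -/
structure IsWeight (M : ℕ → ℝ) : Prop where
  pos : ∀ n, 0 < M n
  zero : M 0 = 1
  choose_le : ∀ n m, ((n + m).choose n : ℝ) ≤ M (n + m) / (M n * M m)

/-- The sequence `M` is non-analytic: `(n! / M n) ^ (1 / n) → 0` as `n → ∞`. -/
def IsNonAnalytic (M : ℕ → ℝ) : Prop :=
  Tendsto (fun n : ℕ => ((n.factorial : ℝ) / M n) ^ (1 / (n : ℝ))) atTop (𝓝 0)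

/-- The uniform norm on `[0,1]`. It is only used for functions that are continuous on `[0,1]`,
so the supremum is that of a bounded set. -/
noncomputable def supNorm {E : Type*} [Norm E] (f : ℝ → E) : ℝ :=
  ⨆ x : Icc (0 : ℝ) 1, ‖f x‖

/-- Membership in `D([0,1], M)`, for a complex-valued function on `[0,1]` (given as a function on
`ℝ` of which only the values on `[0,1]` matter): `f` is `C^∞` on `[0,1]`, with one-sided
derivatives at the endpoints, and `∑ ‖f⁽ⁿ⁾‖_∞ / M n < ∞`. -/
def MemD (M : ℕ → ℝ) (f : ℝ → ℂ) : Prop :=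
  ContDiffOn ℝ ∞ f (Icc 0 1) ∧
    Summable fun n : ℕ => supNorm (iteratedDerivWithin n f (Icc 0 1)) / M n

/-- The map `φ` induces an endomorphism `f ↦ f ∘ φ` of the algebra `D([0,1], M)`:
`f ∘ φ ∈ D([0,1], M)` whenever `f ∈ D([0,1], M)`. -/
def InducesEndomorphism (M : ℕ → ℝ) (φ : ℝ → ℝ) : Prop :=
  ∀ f : ℝ → ℂ, MemD M f → MemD M (f ∘ φ)

/-! By the closed graph theorem `f ↦ f ∘ φ` is bounded, so the derivatives of `v = exp (i s φ)`
satisfy `|v⁽ᵏ⁾| ≤ C * M k * ∑ s ^ j / M j`. Suppose `|φ'| ≥ a > b > r > 1` on an interval. Put `t =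
r * s` and let `n` be the index of the maximal term `μ` of `∑ t ^ k / M k`. The sum at `s = t / r`
is at most a constant times `μ`, and `M n * μ = t ^ n`, so `|v⁽ⁿ⁾| ≤ C₁ * (r * s) ^ n`.

In the other direction, the squared `L²` norms of successive derivatives are nearly log-convex, so
the first ratio, at least `(a * s) ^ 2`, almost persists (`sub_mul_integral_gaussian_le`,
`pow_mul_gaussianEnergy_le`). A Gaussian weight `exp (-B (x - c)²)` with `B` proportional to `s`
suppresses the boundary terms at the price of `4 * B` per step. Non-analyticity gives `n = o(t)`, so
the total loss `4 * B * n` is `o(s ^ 2)` and `v⁽ⁿ⁾` has size at least `(b * s) ^ n` in the mean.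
Hence `(b / r) ^ n ≤ C₁`, which is false for large `t` because `n → ∞`. -/

/-! ### Weight sequences and the maximal term of `∑ t ^ k / M k`. -/

namespace IsNonAnalytic

variable {M : ℕ → ℝ}

theorem eventually_pow_mul_factorial_le (hM : IsWeight M) (h : IsNonAnalytic M) {K : ℝ}
    (hK : 0 < K) : ∀ᶠ n : ℕ in atTop, K ^ n * n.factorial ≤ M n := by
  have h1 : ∀ᶠ n : ℕ in atTop, ((n.factorial : ℝ) / M n) ^ (1 / (n : ℝ)) < K⁻¹ :=
    h.eventually_lt_const (by positivity)
  filter_upwards [h1, eventually_gt_atTop 0] with n hn hn0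
  have hpos : 0 < (n.factorial : ℝ) / M n :=
    div_pos (by exact_mod_cast n.factorial_pos) (hM.pos n)
  have h2 : (n.factorial : ℝ) / M n ≤ K⁻¹ ^ n := by
    have := pow_le_pow_left₀ (by positivity) hn.le n
    rwa [one_div, Real.rpow_inv_natCast_pow hpos.le hn0.ne'] at this
  rw [div_le_iff₀ (hM.pos n), inv_pow, inv_mul_eq_div, le_div_iff₀ (by positivity)] at h2
  linarith

theorem exists_pow_div_le (hM : IsWeight M) (h : IsNonAnalytic M) :
    ∃ C : ℝ, 0 < C ∧ ∀ (n : ℕ) (t : ℝ), 0 ≤ t → t ^ n / M n ≤ C * (t ^ n / n.factorial) := by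
  obtain ⟨N, hN⟩ := eventually_atTop.1 (h.eventually_pow_mul_factorial_le hM one_pos)
  refine ⟨1 + ∑ k ∈ Finset.range N, k.factorial / M k, ?_, fun n t ht => ?_⟩
  · have : 0 ≤ ∑ k ∈ Finset.range N, k.factorial / M k :=
      Finset.sum_nonneg fun k _ => div_nonneg (by positivity) (hM.pos k).le
    linarith
  have hs : ∀ k ∈ Finset.range N, 0 ≤ (k.factorial : ℝ) / M k :=
    fun k _ => div_nonneg (by positivity) (hM.pos k).le
  have key : (n.factorial : ℝ) / M n ≤ 1 + ∑ k ∈ Finset.range N, k.factorial / M k := by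
    rcases lt_or_ge n N with hn | hn
    · have := Finset.single_le_sum hs (Finset.mem_range.2 hn)
      linarith
    · have h1 := hN n hn
      rw [one_pow, one_mul] at h1
      have h2 : (n.factorial : ℝ) / M n ≤ 1 := (div_le_one (hM.pos n)).2 h1
      have h3 := Finset.sum_nonneg hs
      linarith
  have hf : (0 : ℝ) < n.factorial := by exact_mod_cast n.factorial_pos
  calc t ^ n / M n = (n.factorial / M n) * (t ^ n / n.factorial) := by
        have := (hM.pos n).ne'
        field_simp
    _ ≤ _ := by gcongr

theorem summable_pow_div (hM : IsWeight M) (h : IsNonAnalytic M) {t : ℝ} (ht : 0 ≤ t) :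
    Summable fun n => t ^ n / M n := by
  obtain ⟨C, -, hC⟩ := h.exists_pow_div_le hM
  exact Summable.of_nonneg_of_le (fun n => div_nonneg (by positivity) (hM.pos n).le)
    (fun n => hC n t ht) ((Real.summable_pow_div_factorial t).mul_left C)

theorem exists_forall_pow_div_le (hM : IsWeight M) (h : IsNonAnalytic M) {t : ℝ} (ht : 0 < t) :
    ∃ n, ∀ k, t ^ k / M k ≤ t ^ n / M n := by
  have h0 : Tendsto (fun n => t ^ n / M n) atTop (𝓝[>] 0) :=
    tendsto_nhdsWithin_iff.2 ⟨(h.summable_pow_div hM ht.le).tendsto_atTop_zero,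
      Eventually.of_forall fun n => div_pos (by positivity) (hM.pos n)⟩
  -- The reciprocals of the terms tend to infinity, so they attain a minimum.
  have h1 := h0.inv_tendsto_nhdsGT_zero
  rw [← Nat.cofinite_eq_atTop] at h1
  obtain ⟨n, hn⟩ := h1.exists_forall_le
  refine ⟨n, fun k => ?_⟩
  have := hn k
  simp only [Pi.inv_apply] at this
  exact (inv_le_inv₀ (div_pos (by positivity) (hM.pos n))
    (div_pos (by positivity) (hM.pos k))).1 this

end IsNonAnalytic

namespace IsWeight

variable {M : ℕ → ℝ}

theorem mul_le (hM : IsWeight M) (n m : ℕ) : M n * M m ≤ M (n + m) := by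
  have h := hM.choose_le n m
  have h1 : (1 : ℝ) ≤ ((n + m).choose n : ℝ) := by
    exact_mod_cast Nat.choose_pos (Nat.le_add_right n m)
  exact (one_le_div (mul_pos (hM.pos n) (hM.pos m))).1 (h1.trans h)

/-- For large `t` the term of index `N + 1` beats every term of index at most `N`, so the maximal
index tends to infinity. -/
theorem eventually_lt_of_forall_pow_div_le (hM : IsWeight M) (N : ℕ) :
    ∀ᶠ t : ℝ in atTop, ∀ n, (∀ k, t ^ k / M k ≤ t ^ n / M n) → N < n := by
  have h : ∀ᶠ t : ℝ in atTop, ∀ n ∈ Finset.range (N + 1), M (N + 1) / M n < t :=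
    (Finset.eventually_all _).2 fun n _ => eventually_gt_atTop _
  filter_upwards [h, eventually_ge_atTop 1] with t ht ht1 n hn
  by_contra! hnN
  have h1 := ht n (Finset.mem_range.2 (by omega))
  have h2 := hn (N + 1)
  rw [div_lt_iff₀ (hM.pos n)] at h1
  rw [div_le_div_iff₀ (hM.pos _) (hM.pos _)] at h2
  have h3 : t ^ n * t ≤ t ^ (N + 1) := by
    rw [← pow_succ]
    exact pow_le_pow_right₀ ht1 (by omega)
  have h4 : 0 < t ^ n := by positivity
  have h5 := hM.pos n
  nlinarith

/-- If the maximal term of `∑ t ^ k / M k` has index `n`, then `M k ≤ t ^ k * (t ^ n / M n)` for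
all `k ≤ n`. -/
theorem le_pow_mul_of_forall_pow_div_le (hM : IsWeight M) {t : ℝ} (ht : 0 < t) {n : ℕ}
    (hn : ∀ k, t ^ k / M k ≤ t ^ n / M n) {k : ℕ} (hk : k ≤ n) :
    M k ≤ t ^ k * (t ^ n / M n) := by
  obtain ⟨m, rfl⟩ := Nat.exists_eq_add_of_le hk
  have h0 := hn 0
  -- Comparison with the term of index `0` gives `M n ≤ t ^ n`.
  rw [hM.zero, pow_zero, div_one, one_le_div (hM.pos _)] at h0
  have h1 := (hM.mul_le k m).trans h0
  have h2 := (div_le_iff₀ (hM.pos m)).1 (hn m)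
  have h3 : t ^ k * t ^ m ≤ t ^ k * (t ^ (k + m) / M (k + m)) * M m := by
    rw [mul_assoc]; gcongr
  rw [pow_add] at h1
  exact le_of_mul_le_mul_right (h1.trans h3) (hM.pos m)

end IsWeight

/-- Maximality gives `M n ≤ t ^ n`, while `M n ≥ K ^ n * n!` and `n! ≥ (n / e) ^ n`; with `K = e /
ε` this reads `n / ε ≤ t`. -/
theorem IsNonAnalytic.eventually_le_mul_of_forall_pow_div_le {M : ℕ → ℝ} (hM : IsWeight M)
    (h : IsNonAnalytic M) {ε : ℝ} (hε : 0 < ε) :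
    ∀ᶠ t : ℝ in atTop, ∀ n : ℕ, (∀ k, t ^ k / M k ≤ t ^ n / M n) → (n : ℝ) ≤ ε * t := by
  set K : ℝ := Real.exp 1 / ε with hK
  have hK0 : 0 < K := div_pos (Real.exp_pos 1) hε
  obtain ⟨N, hN⟩ := eventually_atTop.1 (h.eventually_pow_mul_factorial_le hM hK0)
  filter_upwards [hM.eventually_lt_of_forall_pow_div_le N, eventually_gt_atTop 0] with t ht ht0 n hn
  have hNn := ht n hn
  have h0 := hn 0
  rw [hM.zero, pow_zero, div_one, one_le_div (hM.pos _)] at h0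
  have h1 := (hN n hNn.le).trans h0
  have hf : (0 : ℝ) < n.factorial := by exact_mod_cast n.factorial_pos
  have h2 : (n : ℝ) ^ n / n.factorial ≤ Real.exp n :=
    Real.pow_div_factorial_le_exp n (by positivity) n
  rw [div_le_iff₀ hf] at h2
  have h3 : ((n : ℝ) / ε) ^ n ≤ t ^ n := by
    refine le_trans ?_ h1
    rw [hK, div_pow, div_pow, ← Real.exp_nat_mul, mul_one, div_mul_eq_mul_div]
    gcongr
  have h4 := (pow_le_pow_iff_left₀ (by positivity) ht0.le (by omega)).1 h3
  rw [div_le_iff₀ hε] at h4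
  linarith

theorem IsNonAnalytic.tsum_div_pow_le {M : ℕ → ℝ} (hM : IsWeight M) (h : IsNonAnalytic M) {r t : ℝ}
    (hr : 1 < r) (ht : 0 < t) {n : ℕ} (hn : ∀ k, t ^ k / M k ≤ t ^ n / M n) :
    ∑' k, (t / r) ^ k / M k ≤ (1 - r⁻¹)⁻¹ * (t ^ n / M n) := by
  have hr1 : r⁻¹ < 1 := inv_lt_one_of_one_lt₀ hr
  have hr0 : 0 ≤ r⁻¹ := by positivity
  rw [← tsum_geometric_of_lt_one hr0 hr1, ← tsum_mul_right]
  refine Summable.tsum_le_tsum (fun k => ?_) (h.summable_pow_div hM (by positivity))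
    ((summable_geometric_of_lt_one hr0 hr1).mul_right _)
  calc (t / r) ^ k / M k = r⁻¹ ^ k * (t ^ k / M k) := by
        rw [div_pow, inv_pow]; ring
    _ ≤ _ := mul_le_mul_of_nonneg_left (hn k) (by positivity)

/-! ### The weighted log-convexity inequality. -/

open MeasureTheory in
/-- A Gaussian-weighted form of the log-convexity of the `L²` norms of successive derivatives. -/
theorem sub_mul_integral_gaussian_le {v₀ v₁ v₂ : ℝ → ℂ} {c d B R : ℝ} (hd : 0 < d) (hB : 0 ≤ B)
    (hR : 0 < R) (h₀ : ∀ x ∈ Icc (c - d) (c + d), HasDerivAt v₀ (v₁ x) x)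
    (h₁ : ∀ x ∈ Icc (c - d) (c + d), HasDerivAt v₁ (v₂ x) x)
    (h₂ : ContinuousOn v₂ (Icc (c - d) (c + d)))
    (h : R * ∫ x in (c - d)..(c + d), Real.exp (-B * (x - c) ^ 2) * ‖v₀ x‖ ^ 2 ≤
      ∫ x in (c - d)..(c + d), Real.exp (-B * (x - c) ^ 2) * ‖v₁ x‖ ^ 2) :
    (R - 2 * B) * (∫ x in (c - d)..(c + d), Real.exp (-B * (x - c) ^ 2) * ‖v₁ x‖ ^ 2) -
        2 * R * (Real.exp (-B * d ^ 2) *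
          (‖v₁ (c + d)‖ * ‖v₀ (c + d)‖ + ‖v₁ (c - d)‖ * ‖v₀ (c - d)‖)) ≤
      ∫ x in (c - d)..(c + d), Real.exp (-B * (x - c) ^ 2) * ‖v₂ x‖ ^ 2 := by
  set W : ℝ → ℝ := fun x => Real.exp (-B * (x - c) ^ 2) with hW
  have hle : c - d ≤ c + d := by linarith
  have hu : uIcc (c - d) (c + d) = Icc (c - d) (c + d) := uIcc_of_le hle
  have hWc : Continuous W := by fun_prop
  have c0 : ContinuousOn v₀ (Icc (c - d) (c + d)) :=
    fun x hx => (h₀ x hx).continuousAt.continuousWithinAt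
  have c1 : ContinuousOn v₁ (Icc (c - d) (c + d)) :=
    fun x hx => (h₁ x hx).continuousAt.continuousWithinAt
  have hWd : ∀ x, HasDerivAt W (W x * (-2 * B * (x - c))) x := fun x => by
    have := ((((hasDerivAt_id' x).sub_const c).pow 2).const_mul (-B)).exp
    refine this.congr_deriv ?_
    simp [hW]; ring
  set F : ℝ → ℝ := fun x => 2 * R * (W x * inner ℝ (v₁ x) (v₀ x)) with hF
  set G : ℝ → ℝ := fun x => 2 * B * ((x - c) * W x) * ‖v₁ x‖ ^ 2 with hG
  set F' : ℝ → ℝ := fun x => 2 * R * (W x * (-2 * B * (x - c)) * inner ℝ (v₁ x) (v₀ x) +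
    W x * (inner ℝ (v₁ x) (v₁ x) + inner ℝ (v₂ x) (v₀ x))) with hF'
  set G' : ℝ → ℝ := fun x => 2 * B * (1 * W x + (x - c) * (W x * (-2 * B * (x - c)))) *
    ‖v₁ x‖ ^ 2 + 2 * B * ((x - c) * W x) * (2 * inner ℝ (v₁ x) (v₂ x)) with hG'
  have dF : ∀ x ∈ uIcc (c - d) (c + d), HasDerivAt F (F' x) x := fun x hx => by
    rw [hu] at hx
    exact ((hWd x).mul ((h₁ x hx).inner ℝ (h₀ x hx))).const_mul (2 * R)
  have dG : ∀ x ∈ uIcc (c - d) (c + d), HasDerivAt G (G' x) x := fun x hx => by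
    rw [hu] at hx
    exact (((((hasDerivAt_id x).sub_const c).mul (hWd x)).const_mul (2 * B))).mul
      ((h₁ x hx).norm_sq)
  have cF' : ContinuousOn F' (Icc (c - d) (c + d)) := by fun_prop
  have cG' : ContinuousOn G' (Icc (c - d) (c + d)) := by fun_prop
  have iF := intervalIntegral.integral_eq_sub_of_hasDerivAt dF
    (cF'.intervalIntegrable_of_Icc hle)
  have iG := intervalIntegral.integral_eq_sub_of_hasDerivAt dG
    (cG'.intervalIntegrable_of_Icc hle)
  have J : ∀ {v : ℝ → ℂ}, ContinuousOn v (Icc (c - d) (c + d)) →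
      IntervalIntegrable (fun x => W x * ‖v x‖ ^ 2) volume (c - d) (c + d) := fun hv =>
    ContinuousOn.intervalIntegrable_of_Icc hle (by fun_prop)
  -- Expand `0 ≤ W * ‖R v₀ + W⁻¹ (W v₁)'‖ ^ 2`, where `W⁻¹ (W v₁)' = v₂ - 2B(x - c) v₁`: the cross
  -- terms are `F'` and `-G'` up to multiples of `W * ‖v₁‖ ^ 2`.
  have key : ∫ x in (c - d)..(c + d), (G' x - F' x) ≤ ∫ x in (c - d)..(c + d),
      (R ^ 2 * (W x * ‖v₀ x‖ ^ 2) + (2 * B - 2 * R) * (W x * ‖v₁ x‖ ^ 2)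
        + W x * ‖v₂ x‖ ^ 2) := by
    refine intervalIntegral.integral_mono_on hle ((cG'.intervalIntegrable_of_Icc hle).sub
      (cF'.intervalIntegrable_of_Icc hle)) ((((J c0).const_mul _).add ((J c1).const_mul _)).add
      (J h₂)) fun x _ => ?_
    have hsq : 0 ≤ W x * ‖R • v₀ x + (v₂ x - (2 * B * (x - c)) • v₁ x)‖ ^ 2 :=
      mul_nonneg (Real.exp_pos _).le (sq_nonneg _)
    rw [norm_add_sq_real, norm_sub_sq_real, inner_sub_right] at hsq
    simp only [norm_smul, real_inner_smul_left, real_inner_smul_right, mul_pow, Real.norm_eq_abs,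
      sq_abs] at hsq
    simp only [hF', hG', real_inner_self_eq_norm_sq]
    rw [real_inner_comm (v₀ x) (v₁ x), real_inner_comm (v₀ x) (v₂ x),
      real_inner_comm (v₂ x) (v₁ x)]
    linarith [hsq]
  rw [intervalIntegral.integral_sub (cG'.intervalIntegrable_of_Icc hle)
      (cF'.intervalIntegrable_of_Icc hle), iF, iG,
    intervalIntegral.integral_add (((J c0).const_mul _).add ((J c1).const_mul _)) (J h₂),
    intervalIntegral.integral_add ((J c0).const_mul _) ((J c1).const_mul _),
    intervalIntegral.integral_const_mul, intervalIntegral.integral_const_mul] at key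
  -- This boundary term has a favourable sign and is dropped; only that of `F` costs anything.
  have hGb : 0 ≤ G (c + d) - G (c - d) := by
    have : G (c + d) - G (c - d) = 2 * B * (d * W (c + d)) * ‖v₁ (c + d)‖ ^ 2 +
        2 * B * (d * W (c - d)) * ‖v₁ (c - d)‖ ^ 2 := by simp only [hG]; ring
    rw [this]
    have := fun x => (Real.exp_pos (-B * (x - c) ^ 2)).le
    have h1 := this (c + d)
    have h2 := this (c - d)
    positivity
  have hFb : F (c + d) - F (c - d) ≤ 2 * R * (Real.exp (-B * d ^ 2) *
      (‖v₁ (c + d)‖ * ‖v₀ (c + d)‖ + ‖v₁ (c - d)‖ * ‖v₀ (c - d)‖)) := by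
    have e1 : W (c + d) = Real.exp (-B * d ^ 2) := by simp [hW]
    have e2 : W (c - d) = Real.exp (-B * d ^ 2) := by simp [hW]
    simp only [hF, e1, e2]
    rw [← mul_sub, ← mul_sub]
    gcongr
    have i1 := real_inner_le_norm (v₁ (c + d)) (v₀ (c + d))
    have i2 := neg_le_of_abs_le (abs_real_inner_le_norm (v₁ (c - d)) (v₀ (c - d)))
    linarith
  have h3 := mul_le_mul_of_nonneg_left h hR.le
  linarith

/-! ### The space `D([0,1], M)` as a Banach space. -/

theorem iteratedDerivWithin_eqOn_of_hasDerivWithinAt {w : ℕ → ℝ → ℂ}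
    (hw : ∀ n, ∀ x ∈ Icc (0 : ℝ) 1, HasDerivWithinAt (w n) (w (n + 1) x) (Icc 0 1) x) (n : ℕ) :
    EqOn (iteratedDerivWithin n (w 0) (Icc 0 1)) (w n) (Icc 0 1) := by
  induction n with
  | zero => intro x _; rw [iteratedDerivWithin_zero]
  | succ n ih =>
    intro x hx
    rw [iteratedDerivWithin_succ, derivWithin_congr ih (ih hx)]
    exact (hw n x hx).derivWithin (uniqueDiffOn_Icc_zero_one x hx)

theorem contDiffOn_of_hasDerivWithinAt {w : ℕ → ℝ → ℂ}
    (hw : ∀ n, ∀ x ∈ Icc (0 : ℝ) 1, HasDerivWithinAt (w n) (w (n + 1) x) (Icc 0 1) x) :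
    ContDiffOn ℝ ∞ (w 0) (Icc 0 1) :=
  contDiffOn_of_differentiableOn_deriv fun m _ => DifferentiableOn.congr
    (fun x hx => (hw m x hx).differentiableWithinAt)
    (iteratedDerivWithin_eqOn_of_hasDerivWithinAt hw m)

theorem supNorm_congr {E : Type*} [Norm E] {f g : ℝ → E} (h : EqOn f g (Icc 0 1)) :
    supNorm f = supNorm g :=
  iSup_congr fun x => by rw [h x.2]

theorem supNorm_restrict {f : C(Icc (0 : ℝ) 1, ℂ)} {h : ℝ → ℂ} (hf : ∀ x, f x = h x) :
    supNorm h = ‖f‖ := by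
  rw [ContinuousMap.norm_eq_iSup_norm, supNorm]
  exact iSup_congr fun x => by rw [hf]

theorem MemD.of_hasDerivWithinAt {M : ℕ → ℝ} {w : ℕ → ℝ → ℂ}
    (hw : ∀ n, ∀ x ∈ Icc (0 : ℝ) 1, HasDerivWithinAt (w n) (w (n + 1) x) (Icc 0 1) x)
    (hs : Summable fun n => supNorm (w n) / M n) : MemD M (w 0) := by
  refine ⟨contDiffOn_of_hasDerivWithinAt hw, hs.congr fun n => ?_⟩
  rw [supNorm_congr (iteratedDerivWithin_eqOn_of_hasDerivWithinAt hw n)]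

/-- Sequences of continuous functions on `[0,1]`, with the `ℓ¹` norm. -/
abbrev ContSeq : Type := lp (fun _ : ℕ => C(Icc (0 : ℝ) 1, ℂ)) 1

namespace ContSeq

variable {M : ℕ → ℝ}

/-- The `n`-th term of a sequence, rescaled by `M n` and extended to `ℝ`. -/
noncomputable def term (M : ℕ → ℝ) (n : ℕ) (g : ContSeq) (x : ℝ) : ℂ :=
  M n * (g : ℕ → C(Icc (0 : ℝ) 1, ℂ)) n (projIcc 0 1 zero_le_one x)

theorem continuous_uncurry_term (M : ℕ → ℝ) (n : ℕ) :
    Continuous (Function.uncurry (term M n)) := by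
  have h1 : Continuous fun p : ContSeq × ℝ => (p.1 : ℕ → C(Icc (0 : ℝ) 1, ℂ)) n :=
    (lp.evalCLM ℂ _ 1 n).continuous.comp continuous_fst
  have h2 : Continuous fun p : ContSeq × ℝ => projIcc (0 : ℝ) 1 zero_le_one p.2 :=
    continuous_projIcc.comp continuous_snd
  exact continuous_const.mul (h1.eval h2)

theorem continuous_term (M : ℕ → ℝ) (n : ℕ) (g : ContSeq) : Continuous (term M n g) :=
  (continuous_uncurry_term M n).comp (Continuous.prodMk_right g)

theorem term_add (n : ℕ) (g h : ContSeq) : term M n (g + h) = term M n g + term M n h := by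
  ext x; simp [term, mul_add]

theorem term_smul (n : ℕ) (c : ℂ) (g : ContSeq) : term M n (c • g) = c • term M n g := by
  ext x; simp [term, mul_left_comm]

theorem norm_eq (g : ContSeq) : ‖g‖ = ∑' n, ‖(g : ℕ → C(Icc (0 : ℝ) 1, ℂ)) n‖ := by
  rw [lp.norm_eq_tsum_rpow (by simp)]; simp

theorem norm_term_le (hM : IsWeight M) (n : ℕ) (g : ContSeq) (x : ℝ) :
    ‖term M n g x‖ ≤ M n * ‖g‖ := by
  rw [term, norm_mul, Complex.norm_real, Real.norm_of_nonneg (hM.pos n).le]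
  exact mul_le_mul_of_nonneg_left ((ContinuousMap.norm_coe_le_norm _ _).trans
    (lp.norm_apply_le_norm one_ne_zero g n)) (hM.pos n).le

theorem ext_of_term (hM : IsWeight M) {g h : ContSeq}
    (H : ∀ n, EqOn (term M n g) (term M n h) (Icc 0 1)) : g = h := by
  refine Subtype.ext (funext fun n => ContinuousMap.ext fun x => ?_)
  have := H n x.2
  rw [term, term, projIcc_val] at this
  exact mul_left_cancel₀ (Complex.ofReal_ne_zero.2 (hM.pos n).ne') this

end ContSeq

open ContSeq

/-- The sequences `(f⁽ⁿ⁾ / M n)` with `f` in `D([0,1], M)`. -/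
noncomputable def jetSpace (M : ℕ → ℝ) : Submodule ℂ ContSeq where
  carrier := {g | ∀ (n : ℕ) (x : ℝ), x ∈ Icc (0 : ℝ) 1 →
    term M n g x = term M n g 0 + ∫ t in (0)..x, term M (n + 1) g t}
  zero_mem' := by
    intro n x _
    simp [term]
  add_mem' := by
    intro g h hg hh n x hx
    simp only [term_add, Pi.add_apply]
    rw [intervalIntegral.integral_add ((continuous_term M _ g).intervalIntegrable _ _)
      ((continuous_term M _ h).intervalIntegrable _ _), hg n x hx, hh n x hx]
    ring
  smul_mem' := by
    intro c g hg n x hx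
    simp only [term_smul, Pi.smul_apply]
    rw [intervalIntegral.integral_smul, hg n x hx, smul_add]

/-- Stating differentiability as an integral identity makes it a closed condition, which yields
completeness. -/
theorem isClosed_jetSpace (M : ℕ → ℝ) : IsClosed (jetSpace M : Set ContSeq) := by
  have : (jetSpace M : Set ContSeq) = ⋂ (n : ℕ) (x : ℝ) (_ : x ∈ Icc (0 : ℝ) 1),
      {g | term M n g x = term M n g 0 + ∫ t in (0)..x, term M (n + 1) g t} := by
    ext g
    simp only [mem_iInter]
    rfl
  rw [this]
  have hc : ∀ n (x : ℝ), Continuous fun g : ContSeq => term M n g x := fun n x =>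
    (continuous_uncurry_term M n).comp (Continuous.prodMk_left x)
  exact isClosed_iInter fun n => isClosed_iInter fun x => isClosed_iInter fun _ =>
    isClosed_eq (hc n x) ((hc n 0).add
      (intervalIntegral.continuous_parametric_intervalIntegral_of_continuous'
        (continuous_uncurry_term M (n + 1)) 0 x))

instance (M : ℕ → ℝ) : CompleteSpace (jetSpace M) :=
  (isClosed_jetSpace M).completeSpace_coe

namespace jetSpace

variable {M : ℕ → ℝ}

theorem hasDerivWithinAt_term (g : jetSpace M) (n : ℕ) (x : ℝ) (hx : x ∈ Icc (0 : ℝ) 1) :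
    HasDerivWithinAt (term M n (g : ContSeq)) (term M (n + 1) (g : ContSeq) x) (Icc 0 1) x := by
  have h := (((continuous_term M (n + 1) (g : ContSeq)).integral_hasStrictDerivAt
    0 x).hasDerivAt.const_add (term M n (g : ContSeq) 0)).hasDerivWithinAt (s := Icc 0 1)
  exact h.congr (fun y hy => g.2 n y hy) (g.2 n x hx)

theorem ext_of_term_zero (hM : IsWeight M) {g h : jetSpace M}
    (H : EqOn (term M 0 (g : ContSeq)) (term M 0 (h : ContSeq)) (Icc 0 1)) : g = h := by
  refine Subtype.ext (ContSeq.ext_of_term hM fun n => ?_)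
  exact (iteratedDerivWithin_eqOn_of_hasDerivWithinAt (hasDerivWithinAt_term g) n).symm.trans
    ((iteratedDerivWithin_congr H).trans
      (iteratedDerivWithin_eqOn_of_hasDerivWithinAt (hasDerivWithinAt_term h) n))

theorem memD_term_zero (hM : IsWeight M) (g : jetSpace M) : MemD M (term M 0 (g : ContSeq)) := by
  refine MemD.of_hasDerivWithinAt (w := fun n => term M n (g : ContSeq)) (hasDerivWithinAt_term g) ?_
  have h := (memℓp_gen_iff (p := 1) (by simp)).1 (lp.memℓp (g : ContSeq))
  refine h.congr fun n => ?_
  rw [supNorm_restrict (f := (M n : ℂ) • ((g : ContSeq) : ℕ → C(Icc (0 : ℝ) 1, ℂ)) n)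
    (fun x => by simp [term]), norm_smul, Complex.norm_real, Real.norm_of_nonneg (hM.pos n).le]
  have := (hM.pos n).ne'
  simp
  field_simp

theorem exists_of_memD (hM : IsWeight M) {f : ℝ → ℂ} (hf : MemD M f) :
    ∃ g : jetSpace M, (∀ n, EqOn (term M n (g : ContSeq)) (iteratedDerivWithin n f (Icc 0 1))
      (Icc 0 1)) ∧ ‖g‖ = ∑' n, supNorm (iteratedDerivWithin n f (Icc 0 1)) / M n := by
  have hc : ∀ n, ContinuousOn (iteratedDerivWithin n f (Icc 0 1)) (Icc 0 1) := fun n =>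
    hf.1.continuousOn_iteratedDerivWithin (by exact_mod_cast le_top) uniqueDiffOn_Icc_zero_one
  let F : ℕ → C(Icc (0 : ℝ) 1, ℂ) := fun n => ⟨_, (hc n).domRestrict⟩
  have hF : ∀ n, ‖((M n : ℂ)⁻¹) • F n‖ = supNorm (iteratedDerivWithin n f (Icc 0 1)) / M n := by
    intro n
    rw [norm_smul, norm_inv, Complex.norm_real, Real.norm_of_nonneg (hM.pos n).le,
      supNorm_restrict (f := F n) (fun x => rfl), inv_mul_eq_div]
  have hmem : Memℓp (fun n => ((M n : ℂ)⁻¹) • F n) 1 := by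
    refine (memℓp_gen_iff (by simp)).2 (hf.2.congr fun n => ?_)
    rw [hF n]; simp
  let g : ContSeq := ⟨_, hmem⟩
  have hg : ∀ n, EqOn (term M n g) (iteratedDerivWithin n f (Icc 0 1)) (Icc 0 1) := by
    intro n x hx
    have h1 : (M n : ℂ) ≠ 0 := Complex.ofReal_ne_zero.2 (hM.pos n).ne'
    have h2 : (g : ℕ → C(Icc (0 : ℝ) 1, ℂ)) n = ((M n : ℂ)⁻¹) • F n := rfl
    rw [term, h2, projIcc_of_mem _ hx, ContinuousMap.smul_apply, smul_eq_mul,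
      mul_inv_cancel_left₀ h1]
    rfl
  have hd : ∀ n, ∀ x ∈ Icc (0 : ℝ) 1, HasDerivWithinAt (iteratedDerivWithin n f (Icc 0 1))
      (iteratedDerivWithin (n + 1) f (Icc 0 1) x) (Icc 0 1) x := by
    intro n x hx
    rw [iteratedDerivWithin_succ]
    exact (hf.1.differentiableOn_iteratedDerivWithin (by exact_mod_cast ENat.natCast_lt_top n)
      uniqueDiffOn_Icc_zero_one x hx).hasDerivWithinAt
  refine ⟨⟨g, fun n x hx => ?_⟩, hg, ?_⟩
  · have hsub : Icc 0 x ⊆ Icc (0 : ℝ) 1 := Icc_subset_Icc_right hx.2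
    have := intervalIntegral.integral_eq_sub_of_hasDerivAt_of_le hx.1
      (continuous_term M n g).continuousOn (f' := term M (n + 1) g) (fun y hy => ?_)
      ((continuous_term M (n + 1) g).intervalIntegrable _ _)
    · rw [this]; ring
    · have hy' : y ∈ Ioo (0 : ℝ) 1 := ⟨hy.1, hy.2.trans_le hx.2⟩
      have hyI := Ioo_subset_Icc_self hy'
      rw [hg (n + 1) hyI]
      exact ((hd n y hyI).congr (hg n) (hg n hyI)).hasDerivAt (Icc_mem_nhds hy'.1 hy'.2)
  · exact (ContSeq.norm_eq g).trans (tsum_congr hF)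

end jetSpace

/-! ### Automatic continuity and the bounds for exponentials. -/

/-- Automatic continuity of the endomorphism `f ↦ f ∘ φ`. -/
theorem InducesEndomorphism.exists_bound {M : ℕ → ℝ} {φ : ℝ → ℝ} (hM : IsWeight M)
    (hφ : MapsTo φ (Icc 0 1) (Icc 0 1)) (h : InducesEndomorphism M φ) :
    ∃ C : ℝ, 0 < C ∧ ∀ f, MemD M f → ∀ n, ∀ x ∈ Icc (0 : ℝ) 1,
      ‖iteratedDerivWithin n (f ∘ φ) (Icc 0 1) x‖ ≤
        C * M n * ∑' k, supNorm (iteratedDerivWithin k f (Icc 0 1)) / M k := by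
  choose T hT using fun g : jetSpace M =>
    jetSpace.exists_of_memD hM (h _ (jetSpace.memD_term_zero hM g))
  have hT0 : ∀ g : jetSpace M, ∀ x ∈ Icc (0 : ℝ) 1,
      term M 0 (T g : ContSeq) x = term M 0 (g : ContSeq) (φ x) := by
    intro g x hx
    rw [(hT g).1 0 hx, iteratedDerivWithin_zero]; rfl
  let L : jetSpace M →ₗ[ℂ] jetSpace M :=
    { toFun := T
      map_add' := fun g g' => jetSpace.ext_of_term_zero hM fun x hx => by
        rw [hT0 _ x hx, Submodule.coe_add, Submodule.coe_add, term_add, term_add, Pi.add_apply,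
          Pi.add_apply, hT0 _ x hx, hT0 _ x hx]
      map_smul' := fun c g => jetSpace.ext_of_term_zero hM fun x hx => by
        rw [hT0 _ x hx, RingHom.id_apply, Submodule.coe_smul, Submodule.coe_smul, term_smul,
          term_smul, Pi.smul_apply, Pi.smul_apply, hT0 _ x hx] }
  have hc : ∀ x, Continuous fun g : jetSpace M => term M 0 (g : ContSeq) x := fun x =>
    ((continuous_uncurry_term M 0).comp (Continuous.prodMk_left x)).comp continuous_subtype_val
  -- The graph is closed because point evaluations are continuous and separate the elements of
  -- `jetSpace M`.
  have hL : Continuous L := L.continuous_of_seq_closed_graph fun u g y hu hy =>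
    jetSpace.ext_of_term_zero hM fun x hx => by
      refine tendsto_nhds_unique (((hc x).tendsto y).comp hy) ?_
      have h1 := ((hc (φ x)).tendsto g).comp hu
      rw [show term M 0 (L g : ContSeq) x = term M 0 (g : ContSeq) (φ x) from hT0 g x hx]
      exact h1.congr fun n => (hT0 (u n) x hx).symm
  obtain ⟨C, hC0, hC⟩ := ContinuousLinearMap.bound (⟨L, hL⟩ : jetSpace M →L[ℂ] jetSpace M)
  refine ⟨C, hC0, fun f hf n x hx => ?_⟩
  obtain ⟨g, hg, hgn⟩ := jetSpace.exists_of_memD hM hf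
  have hfg : EqOn (f ∘ φ) (term M 0 (g : ContSeq) ∘ φ) (Icc 0 1) := fun y hy => by
    rw [Function.comp_apply, Function.comp_apply, hg 0 (hφ hy), iteratedDerivWithin_zero]
  rw [← hgn, iteratedDerivWithin_congr hfg hx, ← (hT g).1 n hx, mul_right_comm, mul_comm]
  exact (norm_term_le hM n _ x).trans (mul_le_mul_of_nonneg_left (hC g) (hM.pos n).le)

theorem memD_ofReal (M : ℕ → ℝ) : MemD M (fun x => (x : ℂ)) := by
  let w : ℕ → ℝ → ℂ
    | 0 => fun x => x
    | 1 => fun _ => 1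
    | _ + 2 => fun _ => 0
  refine MemD.of_hasDerivWithinAt (w := w) (fun n x _ => ?_) ?_
  · match n with
    | 0 => exact Complex.ofRealCLM.hasDerivAt.hasDerivWithinAt
    | 1 => exact hasDerivWithinAt_const _ _ _
    | _ + 2 => exact hasDerivWithinAt_const _ _ _
  · refine summable_of_ne_finset_zero (s := Finset.range 2) fun n hn => ?_
    match n with
    | 0 | 1 => simp at hn
    | _ + 2 => simp [w, supNorm]

theorem InducesEndomorphism.contDiffOn {M : ℕ → ℝ} {φ : ℝ → ℝ} (h : InducesEndomorphism M φ) :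
    ContDiffOn ℝ ∞ φ (Icc 0 1) :=
  Complex.reCLM.contDiff.comp_contDiffOn (h _ (memD_ofReal M)).1

theorem norm_exp_I_mul_ofReal_mul (s x : ℝ) : ‖Complex.exp (Complex.I * s * x)‖ = 1 := by
  rw [mul_assoc, mul_comm, ← Complex.ofReal_mul, Complex.norm_exp_ofReal_mul_I]

theorem hasDerivAt_pow_mul_exp (s : ℝ) (n : ℕ) (x : ℝ) :
    HasDerivAt (fun x : ℝ => (Complex.I * s) ^ n * Complex.exp (Complex.I * s * x))
      ((Complex.I * s) ^ (n + 1) * Complex.exp (Complex.I * s * x)) x := by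
  have h : HasDerivAt (fun x : ℝ => Complex.I * s * (x : ℂ)) (Complex.I * s * 1) x :=
    Complex.ofRealCLM.hasDerivAt.const_mul (Complex.I * s)
  refine (h.cexp.const_mul ((Complex.I * s) ^ n)).congr_deriv ?_
  ring

theorem supNorm_pow_mul_exp {s : ℝ} (hs : 0 ≤ s) (n : ℕ) :
    supNorm (fun x : ℝ => (Complex.I * s) ^ n * Complex.exp (Complex.I * s * x)) = s ^ n := by
  simp [supNorm, norm_exp_I_mul_ofReal_mul, abs_of_nonneg hs]

theorem InducesEndomorphism.exists_exp_bound {M : ℕ → ℝ} {φ : ℝ → ℝ} (hM : IsWeight M)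
    (hna : IsNonAnalytic M) (hφ : MapsTo φ (Icc 0 1) (Icc 0 1)) (h : InducesEndomorphism M φ) :
    ∃ C : ℝ, 0 < C ∧ ∀ s : ℝ, 0 ≤ s → ∀ n, ∀ x ∈ Icc (0 : ℝ) 1,
      ‖iteratedDerivWithin n (fun y => Complex.exp (Complex.I * s * φ y)) (Icc 0 1) x‖ ≤
        C * M n * ∑' k, s ^ k / M k := by
  obtain ⟨C, hC0, hC⟩ := h.exists_bound hM hφ
  refine ⟨C, hC0, fun s hs n x hx => ?_⟩
  let w : ℕ → ℝ → ℂ := fun n x => (Complex.I * s) ^ n * Complex.exp (Complex.I * s * x)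
  have hw : ∀ n, ∀ x ∈ Icc (0 : ℝ) 1, HasDerivWithinAt (w n) (w (n + 1) x) (Icc 0 1) x :=
    fun n x _ => (hasDerivAt_pow_mul_exp s n x).hasDerivWithinAt
  have hsup : ∀ n, supNorm (w n) = s ^ n := supNorm_pow_mul_exp hs
  have hmem : MemD M (w 0) := MemD.of_hasDerivWithinAt hw (by
    simp only [hsup]
    exact hna.summable_pow_div hM hs)
  have key := hC (w 0) hmem n x hx
  have h1 : w 0 ∘ φ = fun y => Complex.exp (Complex.I * s * φ y) := by
    ext y; simp [w]
  simp only [h1, supNorm_congr (iteratedDerivWithin_eqOn_of_hasDerivWithinAt hw _), hsup] at key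
  exact key

/-! ### Growth of the Gaussian energies of successive derivatives. -/

/-- The squared `L²` norm on `[c - d, c + d]` with weight `exp (-B (x - c)²)`. -/
noncomputable def gaussianEnergy (B c d : ℝ) (v : ℝ → ℂ) : ℝ :=
  ∫ x in (c - d)..(c + d), Real.exp (-B * (x - c) ^ 2) * ‖v x‖ ^ 2

theorem gaussianEnergy_nonneg {B c d : ℝ} (hd : 0 ≤ d) (v : ℝ → ℂ) :
    0 ≤ gaussianEnergy B c d v :=
  intervalIntegral.integral_nonneg (by linarith) fun _ _ => by positivity

theorem mul_gaussianEnergy_le {B c d R : ℝ} (hd : 0 ≤ d) {v w : ℝ → ℂ}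
    (hv : ContinuousOn v (Icc (c - d) (c + d))) (hw : ContinuousOn w (Icc (c - d) (c + d)))
    (h : ∀ x ∈ Icc (c - d) (c + d), R * ‖v x‖ ^ 2 ≤ ‖w x‖ ^ 2) :
    R * gaussianEnergy B c d v ≤ gaussianEnergy B c d w := by
  have hle : c - d ≤ c + d := by linarith
  rw [gaussianEnergy, ← intervalIntegral.integral_const_mul]
  refine intervalIntegral.integral_mono_on hle
    (ContinuousOn.intervalIntegrable_of_Icc hle (by fun_prop))
    (ContinuousOn.intervalIntegrable_of_Icc hle (by fun_prop)) fun x hx => ?_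
  rw [mul_left_comm]
  exact mul_le_mul_of_nonneg_left (h x hx) (Real.exp_pos _).le

theorem le_gaussianEnergy {B c d : ℝ} (hB : 0 ≤ B) (hd : 0 ≤ d) {v : ℝ → ℂ}
    (hv : ContinuousOn v (Icc (c - d) (c + d))) (h : ∀ x ∈ Icc (c - d) (c + d), ‖v x‖ = 1) :
    d * Real.exp (-B * (d / 2) ^ 2) ≤ gaussianEnergy B c d v := by
  have hle : c - d ≤ c + d := by linarith
  have hle' : c - d / 2 ≤ c + d / 2 := by linarith
  have hsub : Icc (c - d / 2) (c + d / 2) ⊆ Icc (c - d) (c + d) :=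
    Icc_subset_Icc (by linarith) (by linarith)
  have hc : ContinuousOn (fun x => Real.exp (-B * (x - c) ^ 2) * ‖v x‖ ^ 2)
    (Icc (c - d) (c + d)) := by fun_prop
  calc d * Real.exp (-B * (d / 2) ^ 2)
      = ∫ x in (c - d / 2)..(c + d / 2), Real.exp (-B * (d / 2) ^ 2) := by
        rw [intervalIntegral.integral_const, smul_eq_mul]; ring
    _ ≤ ∫ x in (c - d / 2)..(c + d / 2), Real.exp (-B * (x - c) ^ 2) * ‖v x‖ ^ 2 := by
        refine intervalIntegral.integral_mono_on hle' intervalIntegrable_const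
          ((hc.mono hsub).intervalIntegrable_of_Icc hle') fun x hx => ?_
        rw [h x (hsub hx), one_pow, mul_one, Real.exp_le_exp, neg_mul, neg_mul, neg_le_neg_iff]
        refine mul_le_mul_of_nonneg_left (sq_le_sq' ?_ ?_) hB <;> linarith [hx.1, hx.2]
    _ ≤ _ := by
        refine intervalIntegral.integral_mono_interval (by linarith) hle' (by linarith)
          (Eventually.of_forall fun x => by positivity) (hc.intervalIntegrable_of_Icc hle)

/-- Each step lowers the ratio of consecutive energies by at most `4 * B`: `2 * B` from the weight
and `2 * B` from the boundary terms, which `hbd` absorbs into the energy. After fewer than `n` steps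
the ratio is still at least `ρ`. -/
theorem pow_mul_gaussianEnergy_le {v : ℕ → ℝ → ℂ} {B c d R ρ : ℝ} (hB : 0 ≤ B) (hd : 0 < d)
    (hρ : 0 < ρ) {n : ℕ} (hR : ρ + 4 * B * n ≤ R)
    (hv : ∀ k, ∀ x ∈ Icc (c - d) (c + d), HasDerivAt (v k) (v (k + 1) x) x)
    (h₁ : R * gaussianEnergy B c d (v 0) ≤ gaussianEnergy B c d (v 1))
    (hbd : ∀ k, k + 1 < n → R * (Real.exp (-B * d ^ 2) * (‖v (k + 1) (c + d)‖ * ‖v k (c + d)‖ +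
      ‖v (k + 1) (c - d)‖ * ‖v k (c - d)‖)) ≤ B * (ρ ^ (k + 1) * gaussianEnergy B c d (v 0))) :
    ρ ^ n * gaussianEnergy B c d (v 0) ≤ gaussianEnergy B c d (v n) := by
  have hX : ∀ k, 0 ≤ gaussianEnergy B c d (v k) := fun k => gaussianEnergy_nonneg hd.le _
  have hρR : ∀ k : ℕ, k < n → ρ ≤ R - 4 * B * k := fun k hk => by
    have : (k : ℝ) ≤ n := by exact_mod_cast hk.le
    have := mul_le_mul_of_nonneg_left this hB
    linarith
  have key : ∀ k, k < n → (R - 4 * B * k) * gaussianEnergy B c d (v k) ≤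
      gaussianEnergy B c d (v (k + 1)) ∧
      ρ ^ (k + 1) * gaussianEnergy B c d (v 0) ≤ gaussianEnergy B c d (v (k + 1)) := by
    intro k
    induction k with
    | zero =>
      intro hk
      have h0 := hρR 0 hk
      simp only [Nat.cast_zero, mul_zero, sub_zero, zero_add, pow_one] at h0 ⊢
      exact ⟨h₁, (mul_le_mul_of_nonneg_right h0 (hX 0)).trans h₁⟩
    | succ k ih =>
      intro hk
      obtain ⟨i1, i2⟩ := ih (by omega)
      have hk1 := hρR k (by omega)
      have hk2 := hρR (k + 1) hk
      have e := sub_mul_integral_gaussian_le hd hB (hρ.trans_le hk1) (hv k) (hv (k + 1))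
        (fun x hx => (hv (k + 2) x hx).continuousAt.continuousWithinAt) i1
      have hb := hbd k hk
      set β := Real.exp (-B * d ^ 2) * (‖v (k + 1) (c + d)‖ * ‖v k (c + d)‖ +
        ‖v (k + 1) (c - d)‖ * ‖v k (c - d)‖) with hβ
      have hβ0 : 0 ≤ β := by positivity
      have hRβ : (R - 4 * B * k) * β ≤ R * β :=
        mul_le_mul_of_nonneg_right (by have : 0 ≤ 4 * B * k := by positivity
                                       linarith) hβ0
      have hBX := mul_le_mul_of_nonneg_left i2 hB
      have j1 : (R - 4 * B * (k + 1 : ℕ)) * gaussianEnergy B c d (v (k + 1)) ≤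
          gaussianEnergy B c d (v (k + 2)) := by
        push_cast
        simp only [gaussianEnergy] at *
        linarith
      refine ⟨j1, ?_⟩
      calc ρ ^ (k + 2) * gaussianEnergy B c d (v 0)
          = ρ * (ρ ^ (k + 1) * gaussianEnergy B c d (v 0)) := by ring
        _ ≤ ρ * gaussianEnergy B c d (v (k + 1)) := mul_le_mul_of_nonneg_left i2 hρ.le
        _ ≤ _ := (mul_le_mul_of_nonneg_right hk2 (hX _)).trans j1
  cases n with
  | zero => simp
  | succ n => exact (key n n.lt_succ_self).2

/-! ### The contradiction when `|φ'| > 1`. -/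

/-- If the derivatives of `exp (i s φ)` satisfy the bounds `C M_k ∑ s ^ n / M_n` for all `s ≥ 0`,
then `|φ'|` cannot be larger than `1` on an interval. -/
theorem not_forall_le_abs_derivWithin {M : ℕ → ℝ} (hM : IsWeight M) (hna : IsNonAnalytic M)
    {φ : ℝ → ℝ} (hφ : ContDiffOn ℝ ∞ φ (Icc 0 1)) {C : ℝ} (hC0 : 0 < C)
    (hC : ∀ s : ℝ, 0 ≤ s → ∀ n, ∀ x ∈ Icc (0 : ℝ) 1,
      ‖iteratedDerivWithin n (fun y => Complex.exp (Complex.I * s * φ y)) (Icc 0 1) x‖ ≤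
        C * M n * ∑' k, s ^ k / M k)
    {a c d : ℝ} (ha : 1 < a) (hd : 0 < d) (hI : Icc (c - d) (c + d) ⊆ Ioo 0 1) :
    ¬ ∀ x ∈ Icc (c - d) (c + d), a ≤ |derivWithin φ (Icc 0 1) x| := by
  intro hφa
  obtain ⟨b, hb1, hba⟩ := exists_between ha
  obtain ⟨r, hr1, hrb⟩ := exists_between hb1
  have hr0 : 0 < r := by linarith
  obtain ⟨C₂, hC₂0, hC₂⟩ := hna.exists_pow_div_le hM
  set C₁ : ℝ := C * (1 - r⁻¹)⁻¹ with hC₁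
  have hC₁0 : 0 < C₁ := mul_pos hC0 (inv_pos.2 (sub_pos.2 (inv_lt_one_of_one_lt₀ hr1)))
  -- Chosen so that `B = K * s` satisfies `B * d ^ 2 = 8 * t`: the weight is `exp (-8t)` at the
  -- endpoints and at least `exp (-2t)` on the middle half.
  set K : ℝ := 8 * r / d ^ 2 with hK
  have hK0 : 0 < K := by positivity
  have hab : 0 < a ^ 2 - b ^ 2 := by nlinarith
  obtain ⟨N, hN⟩ := pow_unbounded_of_one_lt C₁ ((one_lt_div hr0).2 hrb)
  -- In order: `n > N` for the final contradiction; `4 * B * n ≤ (a ^ 2 - b ^ 2) * s ^ 2`; `r ^ (2 *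
  -- n) ≤ exp t`; and two size conditions used in the boundary estimate.
  obtain ⟨t, hnN, hn₁, hn₂, ht1, htA⟩ := ((hM.eventually_lt_of_forall_pow_div_le N).and
    ((hna.eventually_le_mul_of_forall_pow_div_le hM
      (show 0 < (a ^ 2 - b ^ 2) / (4 * K * r) by positivity)).and
    ((hna.eventually_le_mul_of_forall_pow_div_le hM (show 0 < 1 / (2 * r) by positivity)).and
    ((eventually_ge_atTop 1).and
      (eventually_ge_atTop (4 * a ^ 2 * C₁ ^ 2 * C₂ ^ 4 / (K * d))))))).exists
  have ht0 : 0 < t := by linarith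
  obtain ⟨n, hn⟩ := hna.exists_forall_pow_div_le hM ht0
  replace hnN := hnN n hn
  replace hn₁ := hn₁ n hn
  replace hn₂ := hn₂ n hn
  set s : ℝ := t / r with hs
  have hs0 : 0 < s := by positivity
  have hts : t = r * s := by rw [hs]; field_simp
  have hst : s ≤ t := div_le_self ht0.le hr1.le
  set μ : ℝ := t ^ n / M n with hμ
  have hμ1 : 1 ≤ μ := by simpa [hM.zero] using hn 0
  have hμe : μ ≤ C₂ * Real.exp t := (hC₂ n t ht0.le).trans
    (mul_le_mul_of_nonneg_left (Real.pow_div_factorial_le_exp t ht0.le n) hC₂0.le)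
  set v : ℕ → ℝ → ℂ := fun k =>
    iteratedDerivWithin k (fun y => Complex.exp (Complex.I * s * φ y)) (Icc 0 1) with hv
  have hII : Icc (c - d) (c + d) ⊆ Icc 0 1 := hI.trans Ioo_subset_Icc_self
  have hvb : ∀ k, ∀ x ∈ Icc (c - d) (c + d), ‖v k x‖ ≤ C₁ * (M k * μ) := fun k x hx => by
    refine (hC s hs0.le k x (hII hx)).trans ?_
    rw [show C₁ * (M k * μ) = C * M k * ((1 - r⁻¹)⁻¹ * μ) by rw [hC₁]; ring]
    exact mul_le_mul_of_nonneg_left (hna.tsum_div_pow_le hM hr1 ht0 hn)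
      (mul_pos hC0 (hM.pos k)).le
  have hvk : ∀ k ≤ n, ∀ x ∈ Icc (c - d) (c + d), ‖v k x‖ ≤ C₁ * (t ^ k * μ ^ 2) :=
    fun k hk x hx => by
      refine (hvb k x hx).trans (mul_le_mul_of_nonneg_left ?_ hC₁0.le)
      rw [pow_two, ← mul_assoc]
      exact mul_le_mul_of_nonneg_right (hM.le_pow_mul_of_forall_pow_div_le ht0 hn hk)
        (by linarith)
  have hvn : ∀ x ∈ Icc (c - d) (c + d), ‖v n x‖ ≤ C₁ * t ^ n := fun x hx => by
    have := hvb n x hx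
    rwa [hμ, mul_div_cancel₀ _ (hM.pos n).ne'] at this
  have hu : ContDiffOn ℝ ∞ (fun y => Complex.exp (Complex.I * s * φ y)) (Icc 0 1) :=
    Complex.contDiff_exp.comp_contDiffOn
      (contDiffOn_const.mul (Complex.ofRealCLM.contDiff.comp_contDiffOn hφ))
  have hvd : ∀ k, ∀ x ∈ Icc (c - d) (c + d), HasDerivAt (v k) (v (k + 1) x) x := by
    intro k x hx
    have h1 : v (k + 1) x = derivWithin (v k) (Icc 0 1) x := by
      simp only [hv]; rw [iteratedDerivWithin_succ]
    rw [h1]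
    exact (hu.differentiableOn_iteratedDerivWithin (by exact_mod_cast ENat.natCast_lt_top k)
      uniqueDiffOn_Icc_zero_one x (hII hx)).hasDerivWithinAt.hasDerivAt
      (Icc_mem_nhds (hI hx).1 (hI hx).2)
  have hvc : ∀ k, ContinuousOn (v k) (Icc (c - d) (c + d)) := fun k x hx =>
    (hvd k x hx).continuousAt.continuousWithinAt
  have hv0 : ∀ x, ‖v 0 x‖ = 1 := fun x => by
    simp only [hv, iteratedDerivWithin_zero]
    exact norm_exp_I_mul_ofReal_mul s (φ x)
  have hv1 : ∀ x ∈ Icc (c - d) (c + d), v 1 x =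
      Complex.exp (Complex.I * s * φ x) * (Complex.I * s * ((derivWithin φ (Icc 0 1) x : ℝ) : ℂ)) := by
    intro x hx
    have h1 : HasDerivWithinAt φ (derivWithin φ (Icc 0 1) x) (Icc 0 1) x :=
      (hφ.differentiableOn (by simp) x (hII hx)).hasDerivWithinAt
    have h2 := (h1.ofReal_comp.const_mul (Complex.I * s)).cexp
    simp only [hv, iteratedDerivWithin_one]
    exact h2.derivWithin (uniqueDiffOn_Icc_zero_one x (hII hx))
  set B : ℝ := K * s with hB
  have hB0 : 0 < B := by positivity
  have hBd : B * d ^ 2 = 8 * t := by rw [hB, hK, hts]; field_simp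
  set X := gaussianEnergy B c d (v 0) with hX
  have hX0 : d * Real.exp (-(2 * t)) ≤ X := by
    have := le_gaussianEnergy (B := B) hB0.le hd.le (hvc 0) (fun x _ => hv0 x)
    rwa [show -B * (d / 2) ^ 2 = -(2 * t) by linear_combination (-1 / 4) * hBd] at this
  have hXpos : 0 < X := lt_of_lt_of_le (by positivity) hX0
  have hlow : ((b * s) ^ 2) ^ n * X ≤ gaussianEnergy B c d (v n) := by
    refine pow_mul_gaussianEnergy_le (R := (a * s) ^ 2) hB0.le hd (by positivity) ?_ hvd ?_ ?_
    · rw [div_mul_eq_mul_div, le_div_iff₀ (by positivity), hts] at hn₁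
      have : n * (4 * K) ≤ (a ^ 2 - b ^ 2) * s := by nlinarith
      rw [hB]
      nlinarith
    · refine mul_gaussianEnergy_le hd.le (hvc 0) (hvc 1) fun x hx => ?_
      rw [hv0, hv1 x hx, norm_mul, norm_exp_I_mul_ofReal_mul]
      simp only [norm_mul, Complex.norm_I, Complex.norm_real, Real.norm_eq_abs, one_mul,
        abs_of_pos hs0, one_pow, mul_one]
      rw [mul_comm a s]
      exact pow_le_pow_left₀ (by positivity) (mul_le_mul_of_nonneg_left (hφa x hx) hs0.le) 2
    -- Boundary terms: `μ ^ 4` costs `exp (4t)` and `r ^ (2 * (k + 1))` costs `exp t`, so the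
    -- endpoint weight `exp (-8t)` leaves `exp (-3t)`, against an initial energy of at least `d *
    -- exp (-2t)`.
    · intro k hk
      have hmemL : c - d ∈ Icc (c - d) (c + d) := ⟨le_rfl, by linarith⟩
      have hmemR : c + d ∈ Icc (c - d) (c + d) := ⟨by linarith, le_rfl⟩
      have hprod : ∀ x ∈ Icc (c - d) (c + d), ‖v (k + 1) x‖ * ‖v k x‖ ≤
          C₁ ^ 2 * C₂ ^ 4 * Real.exp (5 * t) * (s ^ 2) ^ (k + 1) := by
        intro x hx
        have hrt : r ^ (2 * (k + 1)) ≤ Real.exp t := by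
          have h1 : r ≤ Real.exp r := by linarith [Real.add_one_le_exp r]
          calc r ^ (2 * (k + 1)) ≤ Real.exp r ^ (2 * (k + 1)) := by gcongr
            _ = Real.exp ((2 * (k + 1) : ℕ) * r) := (Real.exp_nat_mul _ _).symm
            _ ≤ Real.exp t := by
              refine Real.exp_le_exp.2 ?_
              rw [div_mul_eq_mul_div, one_mul, le_div_iff₀ (by positivity)] at hn₂
              have : ((k + 1 : ℕ) : ℝ) ≤ n := by exact_mod_cast hk.le
              have := mul_le_mul_of_nonneg_right this hr0.le
              push_cast at this ⊢
              linarith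
        calc ‖v (k + 1) x‖ * ‖v k x‖
            ≤ (C₁ * (t ^ (k + 1) * μ ^ 2)) * (C₁ * (t ^ (k + 1) * μ ^ 2)) := by
              refine mul_le_mul (hvk _ hk.le x hx) ((hvk k (by omega) x hx).trans ?_)
                (norm_nonneg _) (by positivity)
              gcongr
              exact k.le_succ
          _ = C₁ ^ 2 * μ ^ 4 * r ^ (2 * (k + 1)) * (s ^ 2) ^ (k + 1) := by
              rw [hts, mul_pow]; ring
          _ ≤ C₁ ^ 2 * (C₂ * Real.exp t) ^ 4 * Real.exp t * (s ^ 2) ^ (k + 1) := by gcongr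
          _ = _ := by
              rw [show 5 * t = (4 : ℕ) * t + t by push_cast; ring, Real.exp_add, Real.exp_nat_mul]
              ring
      have hsum := add_le_add (hprod _ hmemR) (hprod _ hmemL)
      have hfin : 2 * a ^ 2 * s ^ 2 * C₁ ^ 2 * C₂ ^ 4 * Real.exp (-(3 * t)) ≤
          B * (d * Real.exp (-(2 * t))) := by
        rw [div_le_iff₀ (by positivity)] at htA
        have hq : t ^ 2 / 2 ≤ Real.exp t := by
          have := Real.quadratic_le_exp_of_nonneg ht0.le
          linarith
        have hst2 : s * (4 * a ^ 2 * C₁ ^ 2 * C₂ ^ 4) ≤ t * (t * (K * d)) := by gcongr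
        have hexp : Real.exp (-(2 * t)) = Real.exp t * Real.exp (-(3 * t)) := by
          rw [← Real.exp_add]; congr 1; ring
        have h3 : 2 * a ^ 2 * s * C₁ ^ 2 * C₂ ^ 4 ≤ K * d * Real.exp t := by
          have := mul_le_mul_of_nonneg_left hq (show 0 ≤ K * d by positivity)
          linarith
        have h4 := mul_le_mul_of_nonneg_left h3
          (show 0 ≤ s * Real.exp (-(3 * t)) by positivity)
        rw [hexp, hB]
        linarith
      have hb1' : (s ^ 2) ^ (k + 1) ≤ ((b * s) ^ 2) ^ (k + 1) := by
        gcongr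
        exact le_mul_of_one_le_left hs0.le hb1.le
      calc _ ≤ (a * s) ^ 2 * (Real.exp (-B * d ^ 2) *
            (C₁ ^ 2 * C₂ ^ 4 * Real.exp (5 * t) * (s ^ 2) ^ (k + 1) +
              C₁ ^ 2 * C₂ ^ 4 * Real.exp (5 * t) * (s ^ 2) ^ (k + 1))) := by gcongr
        _ = (2 * a ^ 2 * s ^ 2 * C₁ ^ 2 * C₂ ^ 4 * Real.exp (-(3 * t))) * (s ^ 2) ^ (k + 1) := by
            rw [show -B * d ^ 2 = -(3 * t) + -(5 * t) by linear_combination -hBd, Real.exp_add,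
              Real.exp_neg (5 * t)]
            field_simp
            ring
        _ ≤ (B * X) * ((b * s) ^ 2) ^ (k + 1) := by
            refine mul_le_mul (hfin.trans (by gcongr)) hb1' (by positivity) (by positivity)
        _ = _ := by ring
  have hup : gaussianEnergy B c d (v n) ≤ (C₁ * t ^ n) ^ 2 * X := by
    have hpos : 0 < (C₁ * t ^ n) ^ 2 := by positivity
    have := mul_gaussianEnergy_le (B := B) (R := ((C₁ * t ^ n) ^ 2)⁻¹) hd.le (hvc n) (hvc 0)
      fun x hx => by
        rw [hv0, inv_mul_le_iff₀ hpos, one_pow, mul_one]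
        exact pow_le_pow_left₀ (norm_nonneg _) (hvn x hx) 2
    rwa [inv_mul_le_iff₀ hpos] at this
  have h1 := le_of_mul_le_mul_right (hlow.trans hup) hXpos
  rw [pow_right_comm] at h1
  have h2 := (pow_le_pow_iff_left₀ (by positivity) (by positivity) two_ne_zero).1 h1
  have h3 : (b / r) ^ n ≤ C₁ := by
    rw [div_pow, div_le_iff₀ (by positivity)]
    rw [hts, mul_pow, mul_pow, ← mul_assoc] at h2
    exact le_of_mul_le_mul_right h2 (by positivity)
  exact (hN.trans_le ((pow_le_pow_right₀ ((one_lt_div hr0).2 hrb).le hnN.le).trans h3)).false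

theorem theorem1p2 (M : ℕ → ℝ) (hM : IsWeight M) (hna : IsNonAnalytic M)
    (φ : ℝ → ℝ) (hφ : MapsTo φ (Icc 0 1) (Icc 0 1)) (hind : InducesEndomorphism M φ) :
    ContDiffOn ℝ ∞ φ (Icc 0 1) ∧ supNorm (derivWithin φ (Icc 0 1)) ≤ 1 := by
  have hsm := hind.contDiffOn
  refine ⟨hsm, ciSup_le fun x => ?_⟩
  obtain ⟨C, hC0, hC⟩ := hind.exists_exp_bound hM hna hφ
  have hcont : ContinuousOn (derivWithin φ (Icc 0 1)) (Icc 0 1) :=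
    hsm.continuousOn_derivWithin uniqueDiffOn_Icc_zero_one (by simp)
  have hle : ∀ y ∈ Ioo (0 : ℝ) 1, |derivWithin φ (Icc 0 1) y| ≤ 1 := by
    intro y hy
    by_contra! hlt
    obtain ⟨a, ha1, ha⟩ := exists_between hlt
    have hmem := Icc_mem_nhds hy.1 hy.2
    have hev : ∀ᶠ z in 𝓝 y, z ∈ Ioo (0 : ℝ) 1 ∧ a ≤ |derivWithin φ (Icc 0 1) z| :=
      (show ∀ᶠ z in 𝓝 y, z ∈ Ioo (0 : ℝ) 1 from Ioo_mem_nhds hy.1 hy.2).and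
        ((((hcont.continuousAt hmem).abs).eventually_const_lt ha).mono fun _ => le_of_lt)
    obtain ⟨d, hd, hball⟩ := Metric.nhds_basis_closedBall.eventually_iff.1 hev
    rw [Real.closedBall_eq_Icc] at hball
    exact not_forall_le_abs_derivWithin hM hna hsm hC0 hC ha1 hd (fun z hz => (hball hz).1)
      fun z hz => (hball hz).2
  -- The endpoints follow by continuity of the derivative.
  have hclosure : (x : ℝ) ∈ closure (Ioo (0 : ℝ) 1) := by
    rw [closure_Ioo zero_ne_one]; exact x.2
  have := mem_closure_iff_nhdsWithin_neBot.1 hclosure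
  exact le_of_tendsto ((hcont x x.2).mono Ioo_subset_Icc_self).norm
    (eventually_mem_nhdsWithin.mono hle)
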